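/- Write $\mathbb{R}^{p,q}$ for $\mathbb{R}^{p+q}$ with the scalar product $\langle x,y\rangle_{p,q}=\sum_{i\le p}x_iy_i-\sum_{j\le q}x_{p+j}y_{p+j}$. Let $\mathfrak z=\mathbb{R}^{3,4}$ and $\mathfrak v=\mathbb{R}^{4,4}$, and let $J\colon\mathfrak z\to\mathfrak{so}(4,4)$ be any linear map with $J_Z^2=-\langle Z,Z\rangle_{3,4}\,\mathrm{Id}$ for all $Z\in\mathfrak z$ (so $\mathfrak v$ is a minimal admissible module of the Clifford algebra of $\mathbb{R}^{3,4}$). Let $\mathfrak n_{3,4}=\mathfrak z\oplus\mathfrak v$ be the $15$-dimensional two-step nilpotent Lie algebra whose only nontrivial brackets are the $[X,Y]\in\mathfrak z$, $X,Y\in\mathfrak v$, given by $\langle [X,Y],Z\rangle_{3,4}=\langle J_ZX,Y\rangle_{4,4}$, and let $N_{3,4}$ be the connected simply connected Lie group with Lie algebra $\mathfrak n_{3,4}$ and the left-invariant pseudo-Riemannian metric defined by $\langle\cdot,\cdot\rangle=\langle\cdot,\cdot\rangle_{3,4}+\langle\cdot,\cdot\rangle_{4,4}$. Put $\mathbf V=J(\mathfrak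 z)\subset\mathfrak{so}(4,4)$, let $[\mathbf V,\mathbf V]$ be the linear span of the commutators of elements of $\mathbf V$, and let $\mathbf N$ be the normalizer of $\mathbf V$ in $\mathfrak{so}(4,4)$. Theorem 6.3. One has $\mathbf N=[\mathbf V,\mathbf V]$, and for every $Z\in\mathbf V$ and every $Y\in\mathbb{R}^{4,4}$ there is $B\in[\mathbf V,\mathbf V]$ with $[B,Z]=0$ and $B(Y)=Z(Y)$. Moreover, $N_{3,4}$ is a geodesic orbit pseudo-Riemannian nilmanifold: for every tangent vector $\xi$ at the identity $e$, the geodesic through $e$ with initial vector $\xi$ is an orbit $t\mapsto\varphi_t(e)$ of a one-parameter group $(\varphi_t)$ of isometries. It is not naturally reductive: if $\mathfrak h=\mathrm{Der}(\mathfrak n_{3,4})\cap\mathfrak{so}(\mathfrak n_{3,4},\langle\cdot,\cdot\rangle)$ and $\mathfrak g\subset\mathfrak n_{3,4}\rtimes\mathfrak h$ is any Lie subalgebra that projects onto $\mathfrak n_{3,4}\cong(\mathfrak n_{3,4}\rtimes\mathfrak h)/\mathfrak h$ (in particular $\mathfrak g=\mathfrak n_{3,4}\rtimes\mathfrak h$),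 then there is no decomposition $\mathfrak g=(\mathfrak g\cap\mathfrak h)\oplus\mathfrak m$ with $[\mathfrak g\cap\mathfrak h,\mathfrak m]\subset\mathfrak m$ and $\langle[T,Q]_{\mathfrak m},R\rangle+\langle Q,[T,R]_{\mathfrak m}\rangle=0$ for all $T,Q,R\in\mathfrak m$, where $\mathfrak m$ carries the scalar product of $\mathfrak n_{3,4}$ through the identification $\mathfrak m\cong\mathfrak g/(\mathfrak g\cap\mathfrak h)\cong\mathfrak n_{3,4}$. -/

import Mathlib

open scoped ContDiff

noncomputable section

/-! ### Pseudo-Riemannian metrics on a vector space regarded as a manifold -/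

section Metric

variable {E : Type*} [NormedAddCommGroup E] [NormedSpace ℝ E]

/-- A smooth field `g` of nondegenerate symmetric bilinear forms on `E`;
`g p` is the scalar product on the tangent space `T_p E = E`. -/
structure IsPseudoRiemannianMetric (g : E → E → E → ℝ) : Prop where
  smooth : ∀ u w, ContDiff ℝ ∞ (fun p => g p u w)
  add_left : ∀ p u u' w, g p (u + u') w = g p u w + g p u' w
  smul_left : ∀ p (c : ℝ) u w, g p (c • u) w = c * g p u w
  symm : ∀ p u w, g p u w = g p w u
  nondegenerate : ∀ p u, (∀ w, g p u w = 0) → u = 0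

/-- A (smooth, affinely parametrized, complete) geodesic of the Levi-Civita connection of `g`.
The equation is `g(∇_{γ'} γ', w) = 0` for all `w`, written with the Christoffel symbols of the
first kind `Γ_{ij,k} = (∂_i g_{jk} + ∂_j g_{ik} - ∂_k g_{ij}) / 2`. -/
def IsGeodesic (g : E → E → E → ℝ) (γ : ℝ → E) : Prop :=
  ContDiff ℝ ∞ γ ∧ ∀ (t : ℝ) (w : E),
    g (γ t) (deriv (deriv γ) t) w
      + fderiv ℝ (fun p => g p (deriv γ t) w) (γ t) (deriv γ t)
      - (1 / 2 : ℝ) * fderiv ℝ (fun p => g p (deriv γ t) (deriv γ t)) (γ t) w = 0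

/-- `f` is smooth and preserves `g`. -/
def PreservesMetric (g : E → E → E → ℝ) (f : E → E) : Prop :=
  ContDiff ℝ ∞ f ∧ ∀ p u w, g (f p) (fderiv ℝ f p u) (fderiv ℝ f p w) = g p u w

/-- A one-parameter group of isometries of `(E, g)`: a smooth action of the additive group `ℝ`
by isometries (each `φ t` is a diffeomorphism, with inverse `φ (-t)`). -/
structure IsOneParameterIsometryGroup (g : E → E → E → ℝ) (φ : ℝ → E → E) : Prop where
  smooth : ContDiff ℝ ∞ (fun x : ℝ × E => φ x.1 x.2)
  zero : ∀ p, φ 0 p = p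
  add : ∀ s t p, φ (s + t) p = φ s (φ t p)
  isometry : ∀ t, PreservesMetric g (φ t)

/-- `(E, g)` is a pseudo-Riemannian manifold in which, for every initial vector `ξ` at the base
point `o`, the geodesic through `o` with initial vector `ξ` is an orbit of a one-parameter group
of isometries. (A geodesic is determined by its initial point and vector.) -/
def IsGeodesicOrbit (g : E → E → E → ℝ) (o : E) : Prop :=
  IsPseudoRiemannianMetric g ∧
  ∀ ξ : E, ∃ φ : ℝ → E → E, IsOneParameterIsometryGroup g φ ∧
    IsGeodesic g (fun t => φ t o) ∧ deriv (fun t => φ t o) 0 = ξ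

end Metric

/-! ### Pseudo `H`-type algebras and groups -/

/-- The space `ℝ^{p,q}`; its scalar product is `PE.sp`. -/
abbrev PE (p q : ℕ) : Type := Fin p ⊕ Fin q → ℝ

/-- The scalar product `∑_{i ≤ p} x_i y_i - ∑_{j ≤ q} x_{p+j} y_{p+j}` of `ℝ^{p,q}`. -/
def PE.sp {p q : ℕ} (x y : PE p q) : ℝ :=
  ∑ i, x (Sum.inl i) * y (Sum.inl i) - ∑ j, x (Sum.inr j) * y (Sum.inr j)

/-- A pseudo `H`-type structure with centre `𝔷 = ℝ^{r,s}` and complement `𝔳 = ℝ^{l,l}`: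
a linear map `J : 𝔷 → 𝔰𝔬(𝔳)` with `J_Z² = -⟨Z, Z⟩ Id`, i.e. the structure of an admissible
Clifford module on `ℝ^{l,l}`. -/
structure PseudoHType (r s l : ℕ) where
  J : PE r s →ₗ[ℝ] Module.End ℝ (PE l l)
  skew : ∀ Z X Y, PE.sp (J Z X) Y = -PE.sp X (J Z Y)
  sq : ∀ Z X, J Z (J Z X) = -(PE.sp Z Z) • X

namespace PE

variable {p q : ℕ}

lemma sp_comm (x y : PE p q) : sp x y = sp y x := by
  simp only [sp, mul_comm]

lemma sp_add_left (x x' y : PE p q) : sp (x + x') y = sp x y + sp x' y := by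
  simp only [sp, Pi.add_apply, add_mul, Finset.sum_add_distrib]; ring

lemma sp_smul_left (c : ℝ) (x y : PE p q) : sp (c • x) y = c * sp x y := by
  simp only [sp, Pi.smul_apply, smul_eq_mul, mul_assoc, ← Finset.mul_sum]; ring

/-- The scalar product of `ℝ^{p,q}` as a bilinear form. -/
def spForm (p q : ℕ) : PE p q →ₗ[ℝ] PE p q →ₗ[ℝ] ℝ :=
  LinearMap.mk₂ ℝ sp sp_add_left (fun c x y => sp_smul_left c x y)
    (fun x y y' => by rw [sp_comm, sp_add_left, sp_comm y, sp_comm y'])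
    (fun c x y => by rw [sp_comm, sp_smul_left, sp_comm y, smul_eq_mul])

@[simp] lemma spForm_apply (x y : PE p q) : spForm p q x y = sp x y := rfl

/-- The value `⟨e_k, e_k⟩ = ±1` on a standard basis vector. -/
def sign : Fin p ⊕ Fin q → ℝ := Sum.elim (fun _ => 1) (fun _ => -1)

end PE

namespace PseudoHType

open PE

variable {r s l : ℕ} (H : PseudoHType r s l)

/-- The bracket `[X, Y] ∈ 𝔷` of `X, Y ∈ 𝔳`, determined by `⟨[X, Y], Z⟩ = ⟨J_Z X, Y⟩`
(see `sp_bracket`). -/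
def bracket : PE l l →ₗ[ℝ] PE l l →ₗ[ℝ] PE r s :=
  LinearMap.mk₂ ℝ (fun X Y k => sign k * sp (H.J (Pi.single k 1) X) Y)
    (fun X X' Y => by ext k; simp only [map_add, sp_add_left, Pi.add_apply]; ring)
    (fun c X Y => by ext k; simp only [map_smul, sp_smul_left, Pi.smul_apply, smul_eq_mul]; ring)
    (fun X Y Y' => by
      ext k; simp only [← spForm_apply, map_add, Pi.add_apply]; ring)
    (fun c X Y => by
      ext k; simp only [← spForm_apply, map_smul, Pi.smul_apply, smul_eq_mul]; ring)

theorem sp_bracket (X Y : PE l l) (Z : PE r s) : sp (H.bracket X Y) Z = sp (H.J Z X) Y := by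
  have hZ : Z = ∑ k, Z k • (Pi.single k (1 : ℝ) : PE r s) := by
    ext j; simp [Finset.sum_apply, Pi.single_apply]
  conv_rhs => rw [hZ]
  simp only [map_sum, map_smul, LinearMap.sum_apply, LinearMap.smul_apply, ← spForm_apply]
  simp only [bracket, sp, sign, LinearMap.mk₂_apply, Fintype.sum_sum_type, Sum.elim_inl,
    Sum.elim_inr, spForm_apply, smul_eq_mul, sub_eq_add_neg, ← Finset.sum_neg_distrib]
  congr 1 <;> refine Finset.sum_congr rfl fun k _ => ?_ <;> ring

theorem bracket_self (X : PE l l) : H.bracket X X = 0 := by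
  ext k
  have h := H.skew (Pi.single k 1) X X
  rw [sp_comm X] at h
  have h0 : sp (H.J (Pi.single k 1) X) X = 0 := by linarith
  simp [bracket, h0]

/-- The subspace `𝐕 = J(𝔷)`. -/
def V : Submodule ℝ (Module.End ℝ (PE l l)) := LinearMap.range H.J

/-- The span `[𝐕, 𝐕]` of the commutators of elements of `𝐕`. -/
def commV : Submodule ℝ (Module.End ℝ (PE l l)) :=
  Submodule.span ℝ {C | ∃ A ∈ H.V, ∃ B ∈ H.V, C = ⁅A, B⁆}

/-- The normalizer `𝐍` of `𝐕` in `𝔰𝔬(l, l)`. -/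
def normalizerV : Set (Module.End ℝ (PE l l)) :=
  {A | (∀ X Y, sp (A X) Y = -sp X (A Y)) ∧ ∀ W ∈ H.V, ⁅A, W⁆ ∈ H.V}

/-- The space `𝔷 ⊕ 𝔳`. It carries the bracket of the Lie algebra `𝔫_{r,s}` and, through the
exponential coordinates, the multiplication of the simply connected group `N_{r,s}`. -/
def Nil (_ : PseudoHType r s l) : Type := PE r s × PE l l

namespace Nil

variable {H}

instance : NormedAddCommGroup H.Nil := inferInstanceAs (NormedAddCommGroup (PE r s × PE l l))

instance : NormedSpace ℝ H.Nil := inferInstanceAs (NormedSpace ℝ (PE r s × PE l l))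

/-- The component in `𝔷`. -/
def z : H.Nil →ₗ[ℝ] PE r s := LinearMap.fst ℝ (PE r s) (PE l l)

/-- The component in `𝔳`. -/
def v : H.Nil →ₗ[ℝ] PE l l := LinearMap.snd ℝ (PE r s) (PE l l)

/-- The element `Z + X` with `Z ∈ 𝔷` and `X ∈ 𝔳`. -/
def mk (Z : PE r s) (X : PE l l) : H.Nil := (Z, X)

@[simp] lemma z_mk (Z : PE r s) (X : PE l l) : z (mk Z X : H.Nil) = Z := rfl

@[simp] lemma v_mk (Z : PE r s) (X : PE l l) : v (mk Z X : H.Nil) = X := rfl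

lemma ext {a b : H.Nil} (h₁ : z a = z b) (h₂ : v a = v b) : a = b := Prod.ext h₁ h₂

/-- The Lie algebra `𝔫_{r,s}`: `[Z + X, Z' + X'] = [X, X'] ∈ 𝔷`. -/
instance : LieRing H.Nil :=
  { (inferInstance : AddCommGroup H.Nil) with
    bracket := fun a b => mk (H.bracket (v a) (v b)) 0
    add_lie := fun a b c => ext (by simp) (by simp)
    lie_add := fun a b c => ext (by simp) (by simp)
    lie_self := fun a => ext (by simp [H.bracket_self]) (by simp)
    leibniz_lie := fun a b c => ext (by simp) (by simp) }

lemma lie_def (a b : H.Nil) : ⁅a, b⁆ = mk (H.bracket (v a) (v b)) 0 := rfl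

instance : LieAlgebra ℝ H.Nil where
  lie_smul c a b := ext (by simp [lie_def]) (by simp [lie_def])

/-- The group `N_{r,s}` in exponential coordinates: `a * b = a + b + [a, b] / 2`. -/
instance : Group H.Nil where
  mul a b := a + b + (1 / 2 : ℝ) • ⁅a, b⁆
  one := (0 : H.Nil)
  inv a := -a
  mul_assoc a b c := by
    change (a + b + (1 / 2 : ℝ) • ⁅a, b⁆) + c + (1 / 2 : ℝ) • ⁅a + b + (1 / 2 : ℝ) • ⁅a, b⁆, c⁆
      = a + (b + c + (1 / 2 : ℝ) • ⁅b, c⁆) + (1 / 2 : ℝ) • ⁅a, b + c + (1 / 2 : ℝ) • ⁅b, c⁆⁆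
    have h₁ : ⁅⁅a, b⁆, c⁆ = 0 := ext (by simp [lie_def]) (by simp [lie_def])
    have h₂ : ⁅a, ⁅b, c⁆⁆ = 0 := ext (by simp [lie_def]) (by simp [lie_def])
    simp only [add_lie, lie_add, smul_lie, lie_smul, h₁, h₂, smul_add, smul_zero]
    abel
  one_mul a := by
    change (0 : H.Nil) + a + (1 / 2 : ℝ) • ⁅(0 : H.Nil), a⁆ = a
    simp
  mul_one a := by
    change a + (0 : H.Nil) + (1 / 2 : ℝ) • ⁅a, (0 : H.Nil)⁆ = a
    simp
  inv_mul_cancel a := by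
    change -a + a + (1 / 2 : ℝ) • ⁅-a, a⁆ = (0 : H.Nil)
    simp

lemma mul_def (a b : H.Nil) : a * b = a + b + (1 / 2 : ℝ) • ⁅a, b⁆ := rfl

lemma one_def : (1 : H.Nil) = 0 := rfl

lemma inv_def (a : H.Nil) : a⁻¹ = -a := rfl

/-- The scalar product `⟨·,·⟩_{r,s} + ⟨·,·⟩_{l,l}` on `𝔫 = 𝔷 ⊕ 𝔳`. -/
def sp (a b : H.Nil) : ℝ := PE.sp (z a) (z b) + PE.sp (v a) (v b)

end Nil

/-- The left-invariant metric on `N_{r,s}` that equals `⟨·,·⟩` at the identity: tangent vectors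
at `p` are moved to the identity by the differential of the left translation by `p⁻¹`. -/
def metric (p u w : H.Nil) : ℝ :=
  Nil.sp (fderiv ℝ (fun q : H.Nil => p⁻¹ * q) p u) (fderiv ℝ (fun q : H.Nil => p⁻¹ * q) p w)

/-- The isotropy algebra `𝔥 = Der(𝔫) ∩ 𝔰𝔬(𝔫)`. -/
def isotropy : LieSubalgebra ℝ (LieDerivation ℝ H.Nil H.Nil) where
  carrier := {D | ∀ a b, Nil.sp (D a) b = -Nil.sp a (D b)}
  zero_mem' := by intro a b; simp [Nil.sp, PE.sp]
  add_mem' := by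
    intro D D' h h' a b
    have h₁ := h a b
    have h₂ := h' a b
    simp only [Nil.sp, ← spForm_apply, LieDerivation.add_apply, map_add,
      LinearMap.add_apply] at *
    linarith
  smul_mem' := by
    intro c D h a b
    have h₁ := h a b
    simp only [Nil.sp, ← spForm_apply, LieDerivation.smul_apply, map_smul,
      LinearMap.smul_apply, smul_eq_mul] at *
    linear_combination c * h₁
  lie_mem' := by
    intro D D' h h' a b
    have h₁ := h (D' a) b
    have h₂ := h' a (D b)
    have h₃ := h' (D a) b
    have h₄ := h a (D' b)
    simp only [Nil.sp, ← spForm_apply, LieDerivation.commutator_apply, map_sub,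
      LinearMap.sub_apply] at *
    linarith

/-- The Lie algebra `𝔫 ⋊ 𝔥` of the isometry group `N ⋊ H`. For `ξ` in it, `ξ.left ∈ 𝔫` is the
class of `ξ` in `(𝔫 ⋊ 𝔥) / 𝔥`, the tangent space of `N` at the identity. -/
abbrev IsomAlg : Type := LieAlgebra.SemiDirectSum H.Nil H.isotropy H.isotropy.incl

/-- `N_{r,s}` is naturally reductive: a transitive subalgebra `𝔤` of `𝔫 ⋊ 𝔥` (for instance
`𝔫 ⋊ 𝔥` itself), with isotropy subalgebra `𝔨 = 𝔤 ∩ 𝔥`, has a reductive decomposition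
`𝔤 = 𝔨 ⊕ 𝔪` such that `⟨[T, Q]_𝔪, R⟩ + ⟨Q, [T, R]_𝔪⟩ = 0` on `𝔪`. Here `𝔪` is identified with
the tangent space by `T ↦ T.left`, under which `[T, Q]_𝔪` corresponds to `[T, Q].left`. -/
def IsNaturallyReductive : Prop :=
  ∃ (𝔤 : LieSubalgebra ℝ H.IsomAlg) (𝔨 𝔪 : Submodule ℝ H.IsomAlg),
    (∀ a : H.Nil, ∃ ξ ∈ 𝔤, ξ.left = a) ∧
    (∀ ξ, ξ ∈ 𝔨 ↔ ξ ∈ 𝔤 ∧ ξ.left = 0) ∧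
    𝔨 ⊓ 𝔪 = ⊥ ∧ 𝔨 ⊔ 𝔪 = 𝔤.toSubmodule ∧
    (∀ ξ ∈ 𝔨, ∀ T ∈ 𝔪, ⁅ξ, T⁆ ∈ 𝔪) ∧
    ∀ T ∈ 𝔪, ∀ Q ∈ 𝔪, ∀ R ∈ 𝔪,
      Nil.sp (⁅T, Q⁆ : H.IsomAlg).left R.left + Nil.sp Q.left (⁅T, R⁆ : H.IsomAlg).left = 0

/-- The Clifford action of `ℝ^{3,4}` on `ℝ^{4,4}` in an invariant basis `v, J_{Z_1} v, …, J_{Z_7} v`,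
written out; it shows that `PseudoHType 3 4 4` is inhabited. -/
def std34Fun (z : PE 3 4) (x : PE 4 4) : PE 4 4 :=
  Sum.elim
    ![-z (.inl 0) * x (.inl 1) - z (.inl 1) * x (.inl 2) - z (.inl 2) * x (.inl 3) + z (.inr 0) * x (.inr 0)
        + z (.inr 1) * x (.inr 1) + z (.inr 2) * x (.inr 2) + z (.inr 3) * x (.inr 3),
      z (.inl 0) * x (.inl 0) - z (.inl 1) * x (.inl 3) + z (.inl 2) * x (.inl 2) + z (.inr 0) * x (.inr 3)
        + z (.inr 1) * x (.inr 2) - z (.inr 2) * x (.inr 1) - z (.inr 3) * x (.inr 0),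
      z (.inl 0) * x (.inl 3) + z (.inl 1) * x (.inl 0) - z (.inl 2) * x (.inl 1) + z (.inr 0) * x (.inr 2)
        - z (.inr 1) * x (.inr 3) - z (.inr 2) * x (.inr 0) + z (.inr 3) * x (.inr 1),
      -z (.inl 0) * x (.inl 2) + z (.inl 1) * x (.inl 1) + z (.inl 2) * x (.inl 0) + z (.inr 0) * x (.inr 1)
        - z (.inr 1) * x (.inr 0) + z (.inr 2) * x (.inr 3) - z (.inr 3) * x (.inr 2)]
    ![z (.inl 0) * x (.inr 3) + z (.inl 1) * x (.inr 2) + z (.inl 2) * x (.inr 1) + z (.inr 0) * x (.inl 0)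
        - z (.inr 1) * x (.inl 3) - z (.inr 2) * x (.inl 2) - z (.inr 3) * x (.inl 1),
      z (.inl 0) * x (.inr 2) - z (.inl 1) * x (.inr 3) - z (.inl 2) * x (.inr 0) + z (.inr 0) * x (.inl 3)
        + z (.inr 1) * x (.inl 0) - z (.inr 2) * x (.inl 1) + z (.inr 3) * x (.inl 2),
      -z (.inl 0) * x (.inr 1) - z (.inl 1) * x (.inr 0) + z (.inl 2) * x (.inr 3) + z (.inr 0) * x (.inl 2)
        + z (.inr 1) * x (.inl 1) + z (.inr 2) * x (.inl 0) - z (.inr 3) * x (.inl 3),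
      -z (.inl 0) * x (.inr 0) + z (.inl 1) * x (.inr 1) - z (.inl 2) * x (.inr 2) + z (.inr 0) * x (.inl 1)
        - z (.inr 1) * x (.inl 2) + z (.inr 2) * x (.inl 3) + z (.inr 3) * x (.inl 0)]

/-- The pseudo `H`-type structure given by `std34Fun`. -/
def std34 : PseudoHType 3 4 4 where
  J := LinearMap.mk₂ ℝ std34Fun
    (fun z z' x => by
      ext i; rcases i with i | i <;> fin_cases i <;> simp [std34Fun] <;> ring)
    (fun c z x => by
      ext i; rcases i with i | i <;> fin_cases i <;> simp [std34Fun] <;> ring)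
    (fun z x x' => by
      ext i; rcases i with i | i <;> fin_cases i <;> simp [std34Fun] <;> ring)
    (fun c z x => by
      ext i; rcases i with i | i <;> fin_cases i <;> simp [std34Fun] <;> ring)
  skew Z X Y := by
    simp [std34Fun, sp, Fin.sum_univ_succ]; ring
  sq Z X := by
    ext i; rcases i with i | i <;> fin_cases i <;>
      simp [std34Fun, sp, Fin.sum_univ_succ] <;> ring

end PseudoHType

end

/-! Since dim 𝔷 + 1 = 8 = dim 𝔳, a non-null X and the vectors J_c X together span 𝔳, which forces
the identity `J_bracket_self`. Contracting it over a basis of 𝔷 gives 4 X∧Y - J_{[X,Y]} ∈ [𝐕, 𝐕]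
(`four_wedge_sub_mem_commV`). As the X∧Y span 𝔰𝔬(4,4), it follows that 𝔰𝔬(4,4) = 𝐕 + [𝐕, 𝐕].

The operator A ↦ ∑ ε_k J_k A J_k is 5 on 𝐕 and -3 on [𝐕, 𝐕], so these meet in 0. If J_c normalizes
𝐕, every [J_c, J_b] lies in that intersection, so J_c commutes with 𝐕; the operator then acts on J_c
by -7 as well as by 5, so J_c = 0. Hence 𝐍 = [𝐕, 𝐕].

Symmetrizing X∧J_z Y in X and Y and subtracting a multiple of J_z gives elements of [𝐕, 𝐕] that
commute with J_z. A suitable X makes such an element send Y to t J_z Y with t ≠ 0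
(`exists_commV_apply_eq`). After rescaling, it extends to a skew derivation D of 𝔫 that kills z, and
for ξ = z + Y the geodesic lemma ⟨D ξ, η⟩ = ⟨ξ, [ξ, η]⟩ holds. So the orbit of the identity under
the flow of ξ + D is a geodesic.

Natural reductivity would require, for an element of 𝔪 over Z ∈ 𝔷, an isotropy part whose 𝔳-block is
J_Z. Such a block normalizes 𝐕, so J_Z = 0, which is false for Z ≠ 0. -/

/-! ### Scalar products and skew endomorphisms. -/

namespace PE

variable {p q : ℕ}

lemma sp_add_right (x y y' : PE p q) : sp x (y + y') = sp x y + sp x y' := by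
  rw [sp_comm, sp_add_left, sp_comm y, sp_comm y']

lemma sp_smul_right (c : ℝ) (x y : PE p q) : sp x (c • y) = c * sp x y := by
  rw [sp_comm, sp_smul_left, sp_comm y]

lemma sp_neg_right (x y : PE p q) : sp x (-y) = -sp x y := by
  simp only [← spForm_apply, map_neg]

lemma sp_sub_left (x x' y : PE p q) : sp (x - x') y = sp x y - sp x' y := by
  simp only [← spForm_apply, map_sub, LinearMap.sub_apply]

lemma sp_sub_right (x y y' : PE p q) : sp x (y - y') = sp x y - sp x y' := by
  simp only [← spForm_apply, map_sub]

lemma sp_zero_left (y : PE p q) : sp 0 y = 0 := by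
  simp only [← spForm_apply, map_zero, LinearMap.zero_apply]

lemma sp_zero_right (x : PE p q) : sp x 0 = 0 := by
  simp only [← spForm_apply, map_zero]

lemma sp_sum_left {ι : Type*} (t : Finset ι) (f : ι → PE p q) (y : PE p q) :
    sp (∑ i ∈ t, f i) y = ∑ i ∈ t, sp (f i) y := by
  simp only [← spForm_apply, map_sum, LinearMap.sum_apply]

/-- The standard basis vector `e_k`. -/
abbrev e (k : Fin p ⊕ Fin q) : PE p q := Pi.single k 1

lemma sign_mul_self (k : Fin p ⊕ Fin q) : sign k * sign k = 1 := by
  rcases k with k | k <;> simp [sign]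

lemma sp_e_left (k : Fin p ⊕ Fin q) (x : PE p q) : sp (e k) x = sign k * x k := by
  rcases k with k | k <;> simp [sp, sign, Pi.single_apply]

lemma sp_e_self (k : Fin p ⊕ Fin q) : sp (e k) (e k) = sign k := by
  simp [sp_e_left]

lemma sum_smul_e (x : PE p q) : ∑ k, x k • e k = x := by
  ext j; simp [Finset.sum_apply, Pi.single_apply]

lemma sum_sp_e (x : PE p q) : ∑ k, (sign k * sp (e k) x) • e k = x := by
  simp only [sp_e_left, ← mul_assoc, sign_mul_self, one_mul, sum_smul_e]

lemma eq_zero_of_sp (x : PE p q) (h : ∀ y, sp x y = 0) : x = 0 := by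
  rw [← sum_sp_e x]
  exact Finset.sum_eq_zero fun k _ => by rw [sp_comm, h]; simp

lemma eq_of_sp {x x' : PE p q} (h : ∀ y, sp x y = sp x' y) : x = x' :=
  sub_eq_zero.1 <| eq_zero_of_sp _ fun y => by rw [sp_sub_left, h, sub_self]

/-- The skew endomorphism `X ∧ Y : W ↦ ⟨X, W⟩ Y - ⟨Y, W⟩ X`. -/
def wedge (X Y : PE p q) : Module.End ℝ (PE p q) :=
  (spForm p q X).smulRight Y - (spForm p q Y).smulRight X

lemma wedge_apply (X Y W : PE p q) : wedge X Y W = sp X W • Y - sp Y W • X := rfl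

lemma end_add_lie (A B C : Module.End ℝ (PE p q)) : ⁅A + B, C⁆ = ⁅A, C⁆ + ⁅B, C⁆ := by
  simp only [Ring.lie_def, add_mul, mul_add]
  abel

lemma end_smul_lie (t : ℝ) (A C : Module.End ℝ (PE p q)) : ⁅t • A, C⁆ = t • ⁅A, C⁆ := by
  simp only [Ring.lie_def, smul_mul_assoc, mul_smul_comm, smul_sub]

/-- Each of the two terms of the wedge sums to one copy of A, the second by skewness. In particular
the X ∧ Y span the skew endomorphisms. -/
lemma two_smul_eq_sum_wedge {A : Module.End ℝ (PE p q)} (hA : ∀ X Y, sp (A X) Y = -sp X (A Y)) :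
    (2 : ℝ) • A = ∑ k, sign k • wedge (e k) (A (e k)) := by
  refine LinearMap.ext fun W => ?_
  have h₁ : ∑ k, (sign k * sp (e k) W) • A (e k) = A W := by
    conv_rhs => rw [← sum_sp_e W]
    simp only [map_sum, map_smul]
  rw [LinearMap.smul_apply, two_smul]
  simp only [LinearMap.smul_apply, LinearMap.sum_apply, wedge_apply, hA, neg_smul, sub_neg_eq_add,
    smul_add, smul_smul, Finset.sum_add_distrib, h₁, sum_sp_e]

end PE

/-! ### Clifford relations, and the eigenvalues of `cliffordSum`. -/

namespace PseudoHType

open PE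

section General

variable {r s l : ℕ} (H : PseudoHType r s l)

lemma J_J (a b : PE r s) (X : PE l l) :
    H.J a (H.J b X) = -H.J b (H.J a X) - (2 * sp a b) • X := by
  have h := H.sq (a + b) X
  simp only [map_add, LinearMap.add_apply, H.sq, sp_add_left, sp_add_right, sp_comm b a] at h
  have h' : H.J a (H.J b X) + H.J b (H.J a X) = -(2 * sp a b) • X := by
    have : H.J a (H.J b X) + H.J b (H.J a X) =
      (-sp a a • X + H.J b (H.J a X) + (H.J a (H.J b X) + -sp b b • X))
        + sp a a • X + sp b b • X := by module
    rw [this, h]; module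
  rw [eq_sub_iff_add_eq, eq_neg_iff_add_eq_zero]
  rw [add_right_comm, h']; module

lemma J_e_sq (k : Fin r ⊕ Fin s) (X : PE l l) : H.J (e k) (H.J (e k) X) = -sign k • X := by
  rw [H.sq, sp_e_self]

lemma sp_J_self (a : PE r s) (X : PE l l) : sp (H.J a X) X = 0 := by
  have h := H.skew a X X
  rw [sp_comm X] at h
  linarith

lemma sp_J_J (a b : PE r s) (X : PE l l) : sp (H.J a X) (H.J b X) = sp a b * sp X X := by
  have h₁ := H.skew a X (H.J b X)
  have h₂ := H.skew b X (H.J a X)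
  rw [sp_comm] at h₂
  rw [J_J, sp_sub_right, sp_neg_right, sp_smul_right] at h₁
  linarith

lemma bracket_J (a : PE r s) (X : PE l l) : H.bracket X (H.J a X) = sp X X • a :=
  eq_of_sp fun z => by rw [sp_bracket, sp_J_J, sp_smul_left, sp_comm z]; ring

lemma bracket_swap (X Y : PE l l) : H.bracket X Y = -H.bracket Y X := by
  have h := H.bracket_self (X + Y)
  simp only [map_add, LinearMap.add_apply, H.bracket_self, zero_add, add_zero] at h
  exact eq_neg_of_add_eq_zero_right h

lemma sum_J_e (z : PE r s) (W : PE l l) :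
    ∑ k, (sign k * sp (e k) z) • H.J (e k) W = H.J z W := by
  conv_rhs => rw [← sum_sp_e z]
  simp only [map_sum, map_smul, LinearMap.sum_apply, LinearMap.smul_apply]

lemma sum_sp_J_e (X Y W : PE l l) :
    ∑ k, (sign k * sp (H.J (e k) X) Y) • H.J (e k) W = H.J (H.bracket X Y) W := by
  rw [← sum_J_e]
  simp only [← sp_bracket, sp_comm (e _)]

/-- The Casimir-type operator `A ↦ ∑ ε_k J_k A J_k`. -/
def cliffordSum : Module.End ℝ (PE l l) →ₗ[ℝ] Module.End ℝ (PE l l) :=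
  ∑ k, sign k • (LinearMap.mulLeft ℝ (H.J (e k)) ∘ₗ LinearMap.mulRight ℝ (H.J (e k)))

lemma cliffordSum_apply (A : Module.End ℝ (PE l l)) (X : PE l l) :
    H.cliffordSum A X = ∑ k, sign k • H.J (e k) (A (H.J (e k) X)) := by
  simp [cliffordSum, LinearMap.sum_apply]

lemma sum_sign_J_e_sq (A : Module.End ℝ (PE l l)) (X : PE l l) :
    ∑ k, sign k • A (H.J (e k) (H.J (e k) X)) = -((r : ℝ) + s) • A X := by
  simp only [J_e_sq, map_smul, smul_smul, mul_neg, sign_mul_self, Finset.sum_const,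
    Finset.card_univ, Fintype.card_sum, Fintype.card_fin, ← Nat.cast_smul_eq_nsmul ℝ]
  push_cast; module

/-- Moving J_a to the left past J_k leaves -∑ ε_k J_a J_k² = (r + s) J_a, and the anticommutators
contribute -2 J_a. -/
lemma cliffordSum_J (a : PE r s) : H.cliffordSum (H.J a) = ((r : ℝ) + s - 2) • H.J a := by
  refine LinearMap.ext fun X => ?_
  have h (k : Fin r ⊕ Fin s) : sign k • H.J (e k) (H.J a (H.J (e k) X)) =
      -(sign k • H.J a (H.J (e k) (H.J (e k) X)))
        - (2 : ℝ) • ((sign k * sp (e k) a) • H.J (e k) X) := by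
    rw [J_J]; module
  simp only [cliffordSum_apply, h, Finset.sum_sub_distrib, Finset.sum_neg_distrib,
    sum_sign_J_e_sq, ← Finset.smul_sum, sum_J_e, LinearMap.smul_apply]
  module

lemma cliffordSum_J_mul_J (a b : PE r s) : H.cliffordSum (H.J a * H.J b) =
    -((r : ℝ) + s - 2) • (H.J a * H.J b) - (2 : ℝ) • (H.J b * H.J a) := by
  refine LinearMap.ext fun X => ?_
  have h (k : Fin r ⊕ Fin s) : sign k • H.J (e k) (H.J a (H.J b (H.J (e k) X))) =
      -(sign k • H.J (e k) (H.J a (H.J (e k) (H.J b X))))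
        - (2 : ℝ) • ((sign k * sp (e k) b) • H.J (e k) (H.J a X)) := by
    rw [J_J H b, sp_comm b]
    simp only [map_sub, map_neg, map_smul]
    module
  have h' := congrArg (· (H.J b X)) (H.cliffordSum_J a)
  simp only [cliffordSum_apply, LinearMap.smul_apply] at h'
  simp only [cliffordSum_apply, Module.End.mul_apply, h, Finset.sum_sub_distrib,
    Finset.sum_neg_distrib, ← Finset.smul_sum, sum_J_e, LinearMap.smul_apply, LinearMap.sub_apply,
    h']
  module

/-- Antisymmetrizing `cliffordSum_J_mul_J` in a and b merges its two terms into one eigenvalue,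
different from that on 𝐕 when r + s ≠ 3. -/
lemma cliffordSum_of_mem_commV {B : Module.End ℝ (PE l l)} (hB : B ∈ H.commV) :
    H.cliffordSum B = -((r : ℝ) + s - 4) • B := by
  induction hB using Submodule.span_induction with
  | mem C hC =>
    obtain ⟨_, ⟨a, rfl⟩, _, ⟨b, rfl⟩, rfl⟩ := hC
    rw [Ring.lie_def, map_sub, cliffordSum_J_mul_J, cliffordSum_J_mul_J]
    module
  | zero => simp
  | add A B _ _ hA hB => rw [map_add, hA, hB, smul_add]
  | smul c A _ hA => rw [map_smul, hA, smul_comm]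

lemma lie_J_mem_commV (a b : PE r s) : ⁅H.J a, H.J b⁆ ∈ H.commV :=
  Submodule.subset_span ⟨_, ⟨a, rfl⟩, _, ⟨b, rfl⟩, rfl⟩

lemma skew_of_mem_commV {B : Module.End ℝ (PE l l)} (hB : B ∈ H.commV) (X Y : PE l l) :
    sp (B X) Y = -sp X (B Y) := by
  induction hB using Submodule.span_induction with
  | mem C hC =>
    obtain ⟨_, ⟨a, rfl⟩, _, ⟨b, rfl⟩, rfl⟩ := hC
    simp only [Ring.lie_def, LinearMap.sub_apply, Module.End.mul_apply, sp_sub_left, sp_sub_right,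
      H.skew]
    ring
  | zero => simp [sp_zero_left, sp_zero_right]
  | add A B _ _ hA hB =>
    simp only [LinearMap.add_apply, sp_add_left, sp_add_right, hA, hB]; ring
  | smul c A _ hA => simp only [LinearMap.smul_apply, sp_smul_left, sp_smul_right, hA]; ring

lemma lie_lie_J (a b c : PE r s) :
    ⁅⁅H.J a, H.J b⁆, H.J c⁆ = H.J ((4 * sp a c) • b - (4 * sp b c) • a) := by
  refine LinearMap.ext fun X => ?_
  simp only [Ring.lie_def, LinearMap.sub_apply, Module.End.mul_apply, map_sub, map_smul,
    LinearMap.smul_apply]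
  have h₁ := H.J_J a c X
  have h₂ := H.J_J b c X
  rw [H.J_J c a (H.J b X), H.J_J c b (H.J a X), h₁, h₂]
  rw [← sub_eq_zero]
  simp only [map_sub, map_neg, map_smul, J_J H c a, J_J H c b, sp_comm c]
  rw [h₁, h₂]
  simp only [map_sub, map_neg, map_smul]
  module

lemma lie_mem_V_of_mem_commV {B : Module.End ℝ (PE l l)} (hB : B ∈ H.commV) (c : PE r s) :
    ⁅B, H.J c⁆ ∈ H.V := by
  induction hB using Submodule.span_induction with
  | mem C hC =>
    obtain ⟨_, ⟨a, rfl⟩, _, ⟨b, rfl⟩, rfl⟩ := hC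
    rw [lie_lie_J]
    exact ⟨_, rfl⟩
  | zero => rw [Ring.lie_def, zero_mul, mul_zero, sub_zero]; exact zero_mem _
  | add A B _ _ hA hB => rw [end_add_lie]; exact add_mem hA hB
  | smul t A _ hA => rw [end_smul_lie]; exact Submodule.smul_mem _ _ hA

lemma commV_subset_normalizerV : (H.commV : Set (Module.End ℝ (PE l l))) ⊆ H.normalizerV := by
  rintro B hB
  refine ⟨H.skew_of_mem_commV hB, ?_⟩
  rintro _ ⟨c, rfl⟩
  exact H.lie_mem_V_of_mem_commV hB c

end General

/-! ### The splitting of 𝔰𝔬(4,4) and the normalizer of 𝐕. -/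

section Minimal

variable (H : PseudoHType 3 4 4)

lemma J_injective : Function.Injective H.J := by
  rw [← LinearMap.ker_eq_bot, LinearMap.ker_eq_bot']
  intro a ha
  refine eq_zero_of_sp _ fun b => ?_
  have h := H.sp_J_J a b (e (Sum.inl 0))
  rw [ha, LinearMap.zero_apply, sp_zero_left, sp_e_self] at h
  simpa [sign] using h.symm

/-- The map (c, t) ↦ J_c X + t X is injective, because J_c X ⟂ X and c ↦ J_c X scales the scalar
product by ⟨X, X⟩ ≠ 0. Both sides have dimension 8. -/
lemma exists_J_add_smul {X : PE 4 4} (hX : sp X X ≠ 0) (Y : PE 4 4) :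
    ∃ (c : PE 3 4) (t : ℝ), Y = H.J c X + t • X := by
  let F : (PE 3 4 × ℝ) →ₗ[ℝ] PE 4 4 :=
    (LinearMap.applyₗ X ∘ₗ H.J).coprod (LinearMap.toSpanSingleton ℝ _ X)
  have hF (u : PE 3 4 × ℝ) : F u = H.J u.1 X + u.2 • X := by
    simp [F]
  have hinj : Function.Injective F := by
    rw [← LinearMap.ker_eq_bot, LinearMap.ker_eq_bot']
    rintro ⟨c, t⟩ h
    rw [hF] at h
    have h₁ := congrArg (sp · X) h
    simp only [sp_add_left, sp_J_self, sp_smul_left, sp_zero_left, zero_add] at h₁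
    have ht : t = 0 := (mul_eq_zero.1 h₁).resolve_right hX
    have hc : c = 0 := by
      refine eq_zero_of_sp _ fun b => ?_
      have h₂ := H.sp_J_J c b X
      simp only [ht, zero_smul, add_zero] at h
      rw [h, sp_zero_left] at h₂
      exact (mul_eq_zero.1 h₂.symm).resolve_right hX
    rw [hc, ht]; rfl
  have hsurj : Function.Surjective F :=
    (LinearMap.injective_iff_surjective_of_finrank_eq_finrank (by simp)).1 hinj
  obtain ⟨u, hu⟩ := hsurj Y
  exact ⟨u.1, u.2, by rw [← hu, hF]⟩

/-- The identity characterising the minimal module: `J_{[X, Y]} X = ⟨X, X⟩ Y - ⟨X, Y⟩ X`. -/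
lemma J_bracket_self (X Y : PE 4 4) :
    H.J (H.bracket X Y) X = sp X X • Y - sp X Y • X := by
  have key (X : PE 4 4) (hX : sp X X ≠ 0) :
      H.J (H.bracket X Y) X = sp X X • Y - sp X Y • X := by
    obtain ⟨c, t, rfl⟩ := H.exists_J_add_smul hX Y
    simp only [map_add, map_smul, bracket_J, bracket_self, smul_zero, add_zero, sp_add_right,
      sp_comm X (H.J c X), sp_J_self, sp_smul_right, LinearMap.smul_apply]
    module
  set X₀ : PE 4 4 := e (Sum.inl 0)
  have h₀ : sp X₀ X₀ = 1 := by simp [X₀, sp_e_self, sign]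
  by_cases hX : sp X X = 0
  swap
  · exact key X hX
  -- With this c the norms c² ± 2c⟨X, X₀⟩ of X ± c X₀ are positive.
  set c := 1 + 2 * |sp X X₀| with hc
  have hle := neg_abs_le (sp X X₀)
  have hle' := le_abs_self (sp X X₀)
  have hn := abs_nonneg (sp X X₀)
  have h₁ := key (X + c • X₀) (by
    simp only [sp_add_left, sp_add_right, sp_smul_left, sp_smul_right, h₀, hX, sp_comm X₀ X]
    nlinarith)
  have h₂ := key (X - c • X₀) (by
    simp only [sp_sub_left, sp_sub_right, sp_smul_left, sp_smul_right, h₀, hX, sp_comm X₀ X]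
    nlinarith)
  have h₃ := key X₀ (by rw [h₀]; exact one_ne_zero)
  simp only [map_add, map_sub, map_smul, LinearMap.add_apply, LinearMap.sub_apply,
    LinearMap.smul_apply, sp_add_left, sp_add_right, sp_sub_left, sp_sub_right, sp_smul_left,
    sp_smul_right, sp_comm X₀ X] at h₁ h₂ h₃ ⊢
  -- Both sides are quadratic in X, so the parallelogram law recovers the value at X from those at X
  -- ± c X₀ and X₀.
  linear_combination (norm := module) (1 / 2 : ℝ) • h₁ + (1 / 2 : ℝ) • h₂ - (c * c) • h₃

/-- Polarization of `J_bracket_self` in X. Together with `J_bracket_right` it permits exchanging W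
with either entry of the bracket. -/
lemma J_bracket_left (X Y W : PE 4 4) : H.J (H.bracket X Y) W =
    -H.J (H.bracket W Y) X + (2 * sp X W) • Y - sp X Y • W - sp W Y • X := by
  have h₁ := H.J_bracket_self (X + W) Y
  have h₂ := H.J_bracket_self X Y
  have h₃ := H.J_bracket_self W Y
  simp only [map_add, LinearMap.add_apply, sp_add_left, sp_add_right, sp_comm W X] at h₁ h₂ h₃
  linear_combination (norm := module) h₁ - h₂ - h₃

lemma J_bracket_right (X Y W : PE 4 4) : H.J (H.bracket X Y) W =
    -H.J (H.bracket X W) Y - (2 * sp Y W) • X + sp X Y • W + sp X W • Y := by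
  have h := H.J_bracket_left Y X W
  rw [H.bracket_swap Y X, H.bracket_swap W X, map_neg, map_neg, LinearMap.neg_apply,
    LinearMap.neg_apply, sp_comm Y X, sp_comm W X] at h
  linear_combination (norm := module) -h

/-- This is `cliffordSum_J` paired with X and W; 5 = 3 + 4 - 2, and the sign comes from the skewness
of J_k. -/
lemma sum_bracket_J_e (X W : PE 4 4) :
    ∑ k, sign k • H.bracket (H.J (e k) X) (H.J (e k) W) = (-5 : ℝ) • H.bracket X W := by
  refine eq_of_sp fun z => ?_
  have h := congrArg (fun A => sp (A X) W) (H.cliffordSum_J z)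
  simp only [cliffordSum_apply, sp_sum_left, sp_smul_left, LinearMap.smul_apply, H.skew (e _)] at h
  simp only [sp_sum_left, sp_smul_left, sp_bracket]
  push_cast at h
  simp only [mul_neg, Finset.sum_neg_distrib] at h
  linarith

/-- Exchanging Y with J_k W moves the product J_k X, J_k W inside one bracket, where
`sum_bracket_J_e` applies. The other terms are expansions in the basis e_k or contain J_k². -/
lemma sum_J_bracket_J_e (X Y W : PE 4 4) :
    ∑ k, sign k • H.J (H.bracket (H.J (e k) X) Y) (H.J (e k) W) =
      (8 : ℝ) • wedge X Y W - (2 : ℝ) • H.J (H.bracket X Y) W + (7 * sp X Y) • W := by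
  have hk (k : Fin 3 ⊕ Fin 4) : sign k • H.J (H.bracket (H.J (e k) X) Y) (H.J (e k) W) =
      -(H.J (sign k • H.bracket (H.J (e k) X) (H.J (e k) W)) Y)
        - (2 : ℝ) • ((sign k * sp (H.J (e k) W) Y) • H.J (e k) X)
        + (sign k * sp (H.J (e k) X) Y) • H.J (e k) W
        - sign k • (sp X (H.J (e k) (H.J (e k) W)) • Y) := by
    rw [J_bracket_right, H.skew (e k) X (H.J (e k) W), sp_comm Y, map_smul, LinearMap.smul_apply]
    module
  have h₅ : ∑ k, H.J (sign k • H.bracket (H.J (e k) X) (H.J (e k) W)) Y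
      = (-5 : ℝ) • H.J (H.bracket X W) Y := by
    rw [← LinearMap.smul_apply, ← map_smul, ← sum_bracket_J_e, map_sum, LinearMap.sum_apply]
  have h₇ : ∑ k : Fin 3 ⊕ Fin 4, sign k • (sp X (H.J (e k) (H.J (e k) W)) • Y)
      = (-7 * sp X W) • Y := by
    simp only [J_e_sq, sp_smul_right, smul_smul, ← mul_assoc, mul_neg, sign_mul_self,
      Finset.sum_const, Finset.card_univ, Fintype.card_sum, Fintype.card_fin,
      ← Nat.cast_smul_eq_nsmul ℝ]
    norm_num
  simp only [hk, Finset.sum_sub_distrib, Finset.sum_add_distrib, Finset.sum_neg_distrib,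
    ← Finset.smul_sum, sum_sp_J_e, h₅, h₇, wedge_apply]
  have h₁ := H.J_bracket_right X W Y
  have h₂ := H.J_bracket_left W Y X
  simp only [sp_comm W] at h₁ h₂ ⊢
  rw [h₁, h₂]
  simp only [sp_comm Y W]
  module

/-- The components of `X ∧ Y` in `𝐕` and `[𝐕, 𝐕]`. -/
lemma four_wedge_sub_mem_commV (X Y : PE 4 4) :
    (4 : ℝ) • wedge X Y - H.J (H.bracket X Y) ∈ H.commV := by
  -- Up to a multiple of the identity, each commutator is 2 J_{[J_k X, Y]} J_k. The scalar parts
  -- cancel the ⟨X, Y⟩ W term of `sum_J_bracket_J_e`.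
  have h : (4 : ℝ) • wedge X Y - H.J (H.bracket X Y) =
      ∑ k, (sign k / 4) • ⁅H.J (H.bracket (H.J (e k) X) Y), H.J (e k)⁆ := by
    refine LinearMap.ext fun W => ?_
    have hk (k : Fin 3 ⊕ Fin 4) :
        ((sign k / 4) • ⁅H.J (H.bracket (H.J (e k) X) Y), H.J (e k)⁆) W =
          (1 / 2 : ℝ) • (sign k • H.J (H.bracket (H.J (e k) X) Y) (H.J (e k) W))
            + (sign k / 2) • (sp (H.J (e k) (H.J (e k) X)) Y • W) := by
      rw [← sp_bracket, LinearMap.smul_apply, Ring.lie_def, LinearMap.sub_apply,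
        Module.End.mul_apply, Module.End.mul_apply, H.J_J (e k), sp_comm (e k)]
      module
    have h₇ : ∑ k : Fin 3 ⊕ Fin 4, (sign k / 2) • (sp (H.J (e k) (H.J (e k) X)) Y • W)
        = (-7 / 2 * sp X Y) • W := by
      have (k : Fin 3 ⊕ Fin 4) : (sign k / 2) • (sp (H.J (e k) (H.J (e k) X)) Y • W)
          = (-1 / 2 * sp X Y) • W := by
        rw [J_e_sq, sp_smul_left, smul_smul]
        congr 1
        linear_combination (-1 / 2 * sp X Y) * PE.sign_mul_self k
      simp only [this, Finset.sum_const, Finset.card_univ, Fintype.card_sum, Fintype.card_fin,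
        ← Nat.cast_smul_eq_nsmul ℝ]
      module
    simp only [LinearMap.sum_apply, hk, Finset.sum_add_distrib, h₇, ← Finset.smul_sum,
      sum_J_bracket_J_e, LinearMap.sub_apply, LinearMap.smul_apply]
    module
  rw [h]
  exact Submodule.sum_mem _ fun k _ => Submodule.smul_mem _ _ (H.lie_J_mem_commV _ _)

lemma exists_commV_add_J {A : Module.End ℝ (PE 4 4)} (hA : ∀ X Y, sp (A X) Y = -sp X (A Y)) :
    ∃ B ∈ H.commV, ∃ c, A = B + H.J c := by
  refine ⟨∑ k, (sign k / 8) • ((4 : ℝ) • wedge (e k) (A (e k)) - H.J (H.bracket (e k) (A (e k)))),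
    Submodule.sum_mem _ fun k _ => Submodule.smul_mem _ _ (H.four_wedge_sub_mem_commV _ _),
    ∑ k, (sign k / 8) • H.bracket (e k) (A (e k)), ?_⟩
  rw [map_sum, ← Finset.sum_add_distrib]
  have h := two_smul_eq_sum_wedge hA
  have h' : A = (1 / 2 : ℝ) • ((2 : ℝ) • A) := by module
  conv_lhs => rw [h', h, Finset.smul_sum]
  refine Finset.sum_congr rfl fun k _ => ?_
  rw [map_smul]
  module

lemma eq_zero_of_mem_V_of_mem_commV {A : Module.End ℝ (PE 4 4)} (hV : A ∈ H.V)
    (hC : A ∈ H.commV) : A = 0 := by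
  obtain ⟨a, rfl⟩ := hV
  have h₁ := H.cliffordSum_J a
  rw [H.cliffordSum_of_mem_commV hC] at h₁
  have h₂ : (8 : ℝ) • H.J a = 0 := by
    push_cast at h₁
    linear_combination (norm := module) -h₁
  exact (smul_eq_zero.1 h₂).resolve_left (by norm_num)

/-- Used twice: for the equality 𝐍 = [𝐕, 𝐕] and to exclude natural reductivity. -/
lemma J_eq_zero_of_mem_normalizerV {c : PE 3 4} (hc : H.J c ∈ H.normalizerV) : H.J c = 0 := by
  have h (b : PE 3 4) : H.J c * H.J b = H.J b * H.J c := by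
    have := H.eq_zero_of_mem_V_of_mem_commV (hc.2 _ ⟨b, rfl⟩) (H.lie_J_mem_commV c b)
    rwa [Ring.lie_def, sub_eq_zero] at this
  have h₁ := H.cliffordSum_J c
  have h₂ : H.cliffordSum (H.J c) = (-7 : ℝ) • H.J c := by
    refine LinearMap.ext fun X => ?_
    have hb (b : PE 3 4) : H.J b (H.J c (H.J b X)) = H.J c (H.J b (H.J b X)) :=
      (congrArg (· (H.J b X)) (h b)).symm
    simp only [cliffordSum_apply, hb, sum_sign_J_e_sq, LinearMap.smul_apply]
    norm_num
  rw [h₂] at h₁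
  have h₃ : (12 : ℝ) • H.J c = 0 := by
    push_cast at h₁
    linear_combination (norm := module) -h₁
  exact (smul_eq_zero.1 h₃).resolve_left (by norm_num)

/-- The normalizer of `𝐕` in `𝔰𝔬(4, 4)` is `[𝐕, 𝐕]`. -/
theorem normalizerV_eq_commV : H.normalizerV = (H.commV : Set (Module.End ℝ (PE 4 4))) := by
  refine Set.Subset.antisymm (fun A hA => ?_) H.commV_subset_normalizerV
  obtain ⟨B, hB, c, rfl⟩ := H.exists_commV_add_J hA.1
  have hc : H.J c ∈ H.normalizerV := by
    refine ⟨H.skew c, fun W hW => ?_⟩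
    have h₁ := hA.2 W hW
    rw [end_add_lie] at h₁
    exact (Submodule.add_mem_iff_right _ ((H.commV_subset_normalizerV hB).2 W hW)).1 h₁
  rw [H.J_eq_zero_of_mem_normalizerV hc, add_zero]
  exact hB

/-! ### Elements of [𝐕, 𝐕] commuting with a given J_z. -/

/-- Polarization of `bracket_J`. It identifies the 𝐕-component of the symmetrized wedge as a
multiple of J_z, the term subtracted in `centralizing`. -/
lemma bracket_J_add_bracket_J (z : PE 3 4) (X Y : PE 4 4) :
    H.bracket X (H.J z Y) + H.bracket Y (H.J z X) = (2 * sp X Y) • z := by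
  have h := H.bracket_J z (X + Y)
  simp only [map_add, LinearMap.add_apply, bracket_J, sp_add_left, sp_add_right, sp_comm Y X] at h
  linear_combination (norm := module) h

/-- An element of `[𝐕, 𝐕]` that commutes with `J_z`. -/
def centralizing (z : PE 3 4) (X Y : PE 4 4) : Module.End ℝ (PE 4 4) :=
  (2 : ℝ) • (wedge X (H.J z Y) + wedge Y (H.J z X)) - sp X Y • H.J z

lemma centralizing_mem_commV (z : PE 3 4) (X Y : PE 4 4) : H.centralizing z X Y ∈ H.commV := by
  have h : H.centralizing z X Y =
      (1 / 2 : ℝ) • (((4 : ℝ) • wedge X (H.J z Y) - H.J (H.bracket X (H.J z Y)))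
        + ((4 : ℝ) • wedge Y (H.J z X) - H.J (H.bracket Y (H.J z X)))) := by
    have h' := congrArg H.J (H.bracket_J_add_bracket_J z X Y)
    rw [map_add, map_smul] at h'
    rw [centralizing]
    linear_combination (norm := module) (1 / 2 : ℝ) • h'
  rw [h]
  exact Submodule.smul_mem _ _ (add_mem (H.four_wedge_sub_mem_commV _ _)
    (H.four_wedge_sub_mem_commV _ _))

lemma lie_centralizing (z : PE 3 4) (X Y : PE 4 4) : ⁅H.centralizing z X Y, H.J z⁆ = 0 := by
  refine LinearMap.ext fun W => ?_
  have h₁ := H.skew z X W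
  have h₂ := H.skew z Y W
  have h₃ := H.skew z X (H.J z W)
  have h₄ := H.skew z Y (H.J z W)
  rw [H.sq, sp_smul_right] at h₃ h₄
  simp only [centralizing, Ring.lie_def, LinearMap.sub_apply, Module.End.mul_apply,
    LinearMap.smul_apply, LinearMap.add_apply, wedge_apply, map_sub, map_add, map_smul, h₁, h₂, h₃,
    h₄, H.sq, LinearMap.zero_apply]
  module

lemma centralizing_apply (z : PE 3 4) (X Y : PE 4 4) : H.centralizing z X Y Y =
    sp X Y • H.J z Y - (2 * sp (H.J z X) Y) • Y + (2 * sp Y Y) • H.J z X := by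
  simp only [centralizing, LinearMap.sub_apply, LinearMap.smul_apply, LinearMap.add_apply,
    wedge_apply, sp_J_self]
  module

theorem exists_commV_apply_eq (z : PE 3 4) (Y : PE 4 4) :
    ∃ B ∈ H.commV, ⁅B, H.J z⁆ = 0 ∧ B Y = H.J z Y := by
  suffices h : ∃ (X : PE 4 4) (t : ℝ), t ≠ 0 ∧ H.centralizing z X Y Y = t • H.J z Y by
    obtain ⟨X, t, ht, h⟩ := h
    refine ⟨t⁻¹ • H.centralizing z X Y, Submodule.smul_mem _ _ (H.centralizing_mem_commV z X Y),
      by rw [end_smul_lie, lie_centralizing, smul_zero], ?_⟩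
    rw [LinearMap.smul_apply, h, smul_smul, inv_mul_cancel₀ ht, one_smul]
  by_cases hq : sp Y Y = 0
  swap
  -- For X = Y the middle term of `centralizing_apply` vanishes, and 3 = 1 + 2.
  · refine ⟨Y, 3 * sp Y Y, by simpa using hq, ?_⟩
    rw [centralizing_apply, sp_J_self]
    module
  simp only [centralizing_apply, hq, mul_zero, zero_smul, add_zero]
  by_cases hY : Y = 0
  · exact ⟨0, 1, one_ne_zero, by simp [hY, sp_zero_right]⟩
  obtain ⟨X, hX⟩ : ∃ X, sp X Y ≠ 0 := by
    by_contra! h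
    exact hY (eq_zero_of_sp _ fun y => by rw [sp_comm, h])
  by_cases h : ∃ W, sp W Y ≠ 0 ∧ sp W (H.J z Y) = 0
  · obtain ⟨W, hW, hJ⟩ := h
    refine ⟨W, sp W Y, hW, ?_⟩
    rw [H.skew, hJ]
    module
  push Not at h
  -- No vector is orthogonal to J_z Y without being orthogonal to Y, so J_z Y and Y are
  -- proportional. The vector tested below is orthogonal to J_z Y by construction.
  have hJ : sp X Y • H.J z Y = sp X (H.J z Y) • Y := by
    refine eq_of_sp fun W => ?_
    by_contra hne
    refine h (sp X (H.J z Y) • W - sp W (H.J z Y) • X) (fun h₀ => hne ?_) ?_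
    · rw [sp_sub_left, sp_smul_left, sp_smul_left] at h₀
      rw [sp_smul_left, sp_smul_left, sp_comm Y, sp_comm (H.J z Y)]
      linarith
    · rw [sp_sub_left, sp_smul_left, sp_smul_left]
      ring
  refine ⟨X, 3 * sp X Y, by simpa using hX, ?_⟩
  rw [H.skew]
  linear_combination (norm := module) (-2 : ℝ) • hJ

end Minimal

end PseudoHType

/-! ### The left-invariant metric in exponential coordinates. -/

noncomputable section

namespace PseudoHType

variable {r s l : ℕ} {H : PseudoHType r s l}

namespace Nil

instance : FiniteDimensional ℝ H.Nil := inferInstanceAs (FiniteDimensional ℝ (PE r s × PE l l))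

lemma z_lie (a b : H.Nil) : z ⁅a, b⁆ = H.bracket (v a) (v b) := rfl

lemma v_lie (a b : H.Nil) : v ⁅a, b⁆ = 0 := rfl

lemma lie_lie_left (a b c : H.Nil) : ⁅⁅a, b⁆, c⁆ = 0 :=
  ext (by simp [lie_def]) (by simp [lie_def])

lemma lie_lie_right (a b c : H.Nil) : ⁅a, ⁅b, c⁆⁆ = 0 :=
  ext (by simp [lie_def]) (by simp [lie_def])

lemma sp_comm (a b : H.Nil) : sp a b = sp b a := by
  simp only [sp, PE.sp_comm]

lemma sp_add_left (a a' b : H.Nil) : sp (a + a') b = sp a b + sp a' b := by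
  simp only [sp, map_add, PE.sp_add_left]; ring

lemma sp_smul_left (c : ℝ) (a b : H.Nil) : sp (c • a) b = c * sp a b := by
  simp only [sp, map_smul, PE.sp_smul_left]; ring

lemma eq_zero_of_sp (a : H.Nil) (h : ∀ b, sp a b = 0) : a = 0 := by
  refine ext (PE.eq_zero_of_sp _ fun Z => ?_) (PE.eq_zero_of_sp _ fun X => ?_)
  · simpa [sp, PE.sp_zero_right] using h (mk Z 0)
  · simpa [sp, PE.sp_zero_right] using h (mk 0 X)

/-- The scalar product of `𝔫` as a continuous bilinear map. -/
def spL : H.Nil →L[ℝ] H.Nil →L[ℝ] ℝ :=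
  LinearMap.toContinuousLinearMap ((LinearMap.toContinuousLinearMap).toLinearMap ∘ₗ
    LinearMap.mk₂ ℝ sp sp_add_left (fun c a b => sp_smul_left c a b)
      (fun a b b' => by rw [sp_comm, sp_add_left, sp_comm b, sp_comm b'])
      (fun c a b => by rw [sp_comm, sp_smul_left, sp_comm b, smul_eq_mul]))

lemma spL_apply (a b : H.Nil) : spL a b = sp a b := rfl

/-- The bracket of `𝔫` as a continuous bilinear map. -/
def lieL : H.Nil →L[ℝ] H.Nil →L[ℝ] H.Nil :=
  LinearMap.toContinuousLinearMap ((LinearMap.toContinuousLinearMap).toLinearMap ∘ₗ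
    LinearMap.mk₂ ℝ (fun a b => ⁅a, b⁆) add_lie (fun c a b => smul_lie c a b) lie_add
      (fun c a b => lie_smul c a b))

lemma lieL_apply (a b : H.Nil) : lieL a b = ⁅a, b⁆ := rfl

/-- The differential at `p` of the left translation by `p⁻¹`, applied to `u`. -/
def triv (p u : H.Nil) : H.Nil := u - (1 / 2 : ℝ) • ⁅p, u⁆

lemma triv_zero_left (u : H.Nil) : triv 0 u = u := by simp [triv]

lemma triv_triv_neg (p u : H.Nil) : triv p (triv (-p) u) = u := by
  simp only [triv, lie_sub, lie_smul, neg_lie, smul_neg, lie_neg, lie_lie_right, smul_zero]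
  module

lemma fderiv_inv_mul (p u : H.Nil) : fderiv ℝ (fun q : H.Nil => p⁻¹ * q) p u = triv p u := by
  have h : HasFDerivAt (fun q : H.Nil => p⁻¹ * q)
      (ContinuousLinearMap.id ℝ H.Nil + (1 / 2 : ℝ) • lieL (-p)) p := by
    have := ((hasFDerivAt_id (𝕜 := ℝ) p).const_add (-p)).add
      (((lieL (-p)).hasFDerivAt (x := p)).const_smul (1 / 2 : ℝ))
    convert! this using 1
  rw [h.fderiv]
  simp only [triv, add_apply, smul_apply, lieL_apply,
    ContinuousLinearMap.id_apply, neg_lie]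
  module

lemma metric_apply (p u w : H.Nil) : H.metric p u w = sp (triv p u) (triv p w) := by
  rw [metric, fderiv_inv_mul, fderiv_inv_mul]

lemma hasFDerivAt_triv (p u : H.Nil) :
    HasFDerivAt (fun p => triv p u) (-((1 / 2 : ℝ) • lieL.flip u)) p := by
  convert! (((lieL.flip u).hasFDerivAt (x := p)).const_smul (1 / 2 : ℝ)).const_sub u using 1

lemma fderiv_metric (p u w x : H.Nil) : fderiv ℝ (fun p => H.metric p u w) p x =
    -(1 / 2) * (sp (triv p u) ⁅x, w⁆ + sp (triv p w) ⁅x, u⁆) := by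
  have h := spL.hasFDerivAt_of_bilinear (hasFDerivAt_triv p u) (hasFDerivAt_triv p w)
  simp only [spL_apply] at h
  simp only [metric_apply]
  rw [h.fderiv]
  simp only [add_apply, ContinuousLinearMap.precompR_apply,
    ContinuousLinearMap.precompL_apply, neg_apply,
    smul_apply, ContinuousLinearMap.flip_apply, lieL_apply, map_neg, map_smul,
    spL_apply, sp_comm ⁅x, u⁆, smul_eq_mul, ContinuousLinearMap.compL_apply,
    ContinuousLinearMap.comp_apply]
  ring

end Nil

open Nil

lemma isPseudoRiemannianMetric_metric : IsPseudoRiemannianMetric H.metric where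
  smooth u w := by
    have h (u : H.Nil) : ContDiff ℝ ∞ (fun p => triv p u) :=
      ContDiff.sub contDiff_const
        (ContDiff.const_smul (1 / 2 : ℝ) (lieL.flip u).contDiff :
          ContDiff ℝ ∞ (fun p => (1 / 2 : ℝ) • lieL.flip u p))
    have := (spL (H := H)).isBoundedBilinearMap.contDiff.comp ((h u).prodMk (h w))
    simp only [metric_apply]
    exact this
  add_left p u u' w := by
    simp only [metric_apply, ← sp_add_left]
    congr 1
    simp only [triv, lie_add]
    module
  smul_left p c u w := by
    simp only [metric_apply, ← sp_smul_left]
    congr 1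
    simp only [triv, lie_smul]
    module
  symm p u w := by simp only [metric_apply, Nil.sp_comm]
  nondegenerate p u h := by
    simp only [metric_apply] at h
    have h₁ : triv p u = 0 := Nil.eq_zero_of_sp _ fun w => by
      rw [← triv_triv_neg p w, h]
    have h₂ := triv_triv_neg (-p) u
    rw [neg_neg, h₁] at h₂
    simpa [triv] using h₂.symm

/-- A skew derivation of `𝔫`. -/
structure IsSkewDerivation (D : H.Nil →L[ℝ] H.Nil) : Prop where
  leibniz : ∀ a b, D ⁅a, b⁆ = ⁅D a, b⁆ + ⁅a, D b⁆
  skew : ∀ a b, Nil.sp (D a) b = -Nil.sp a (D b)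

/-! ### Killing flows and the geodesic lemma. -/

section Flow

variable (D : H.Nil →L[ℝ] H.Nil) (ξ : H.Nil)

/-- The linear part `D + ad ξ / 2` of the affine vector field `affineField D ξ`. -/
def linearField : H.Nil →L[ℝ] H.Nil := D + (1 / 2 : ℝ) • lieL ξ

lemma linearField_apply (p : H.Nil) : linearField D ξ p = D p + (1 / 2 : ℝ) • ⁅ξ, p⁆ := rfl

/-- The Killing field `p ↦ ξ + D p + [ξ, p] / 2` on `N`, made linear on `N × ℝ`. -/
def affineField : (H.Nil × ℝ) →L[ℝ] (H.Nil × ℝ) :=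
  ((linearField D ξ).coprod (ContinuousLinearMap.toSpanSingleton ℝ ξ)).prod 0

lemma affineField_apply (u : H.Nil × ℝ) :
    affineField D ξ u = (linearField D ξ u.1 + u.2 • ξ, 0) := by
  simp [affineField]

/-- The flow of `affineField`. -/
def affineFlow (t : ℝ) : (H.Nil × ℝ) →L[ℝ] (H.Nil × ℝ) := NormedSpace.exp (t • affineField D ξ)

lemma affineFlow_zero : affineFlow D ξ 0 = 1 := by
  simp [affineFlow]

lemma affineFlow_add (t t' : ℝ) (u : H.Nil × ℝ) :
    affineFlow D ξ (t + t') u = affineFlow D ξ t (affineFlow D ξ t' u) := by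
  let _ : NormedAlgebra ℚ ((H.Nil × ℝ) →L[ℝ] (H.Nil × ℝ)) := NormedAlgebra.restrictScalars ℚ ℝ _
  rw [affineFlow, add_smul, NormedSpace.exp_add_of_commute
    (((Commute.refl (affineField D ξ)).smul_left t).smul_right t')]
  rfl

lemma contDiff_affineFlow : ContDiff ℝ ∞ (affineFlow D ξ) := by
  have h : ContDiff ℝ ∞ (NormedSpace.exp : ((H.Nil × ℝ) →L[ℝ] (H.Nil × ℝ)) → _) :=
    AnalyticOnNhd.contDiff (𝕜 := ℝ) fun x _ => NormedSpace.exp_analytic x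
  exact h.comp (contDiff_id.smul contDiff_const)

lemma hasDerivAt_affineFlow (t : ℝ) (u : H.Nil × ℝ) :
    HasDerivAt (fun t => affineFlow D ξ t u) (affineField D ξ (affineFlow D ξ t u)) t := by
  have h := hasDerivAt_exp_smul_const' (𝕂 := ℝ) (affineField D ξ) t
  exact (ContinuousLinearMap.apply ℝ _ u).hasFDerivAt.comp_hasDerivAt t h

lemma hasDerivAt_affineFlow' (t : ℝ) (u : H.Nil × ℝ) :
    HasDerivAt (fun t => affineFlow D ξ t u) (affineFlow D ξ t (affineField D ξ u)) t := by
  have h := hasDerivAt_exp_smul_const (𝕂 := ℝ) (affineField D ξ) t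
  exact (ContinuousLinearMap.apply ℝ _ u).hasFDerivAt.comp_hasDerivAt t h

lemma hasDerivAt_bilinear {F : Type*} [NormedAddCommGroup F] [NormedSpace ℝ F]
    (L : H.Nil →L[ℝ] H.Nil →L[ℝ] F) {a b : ℝ → H.Nil} {a' b' : H.Nil} {t : ℝ}
    (ha : HasDerivAt a a' t) (hb : HasDerivAt b b' t) :
    HasDerivAt (fun t => L (a t) (b t)) (L (a t) b' + L a' (b t)) t := by
  have h := L.isBoundedBilinearMap.hasFDerivAt (a t, b t)
  exact h.comp_hasDerivAt t (ha.prodMk hb)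

lemma eq_of_hasDerivAt_zero {F : Type*} [NormedAddCommGroup F] [NormedSpace ℝ F] {f : ℝ → F}
    (h : ∀ t, HasDerivAt f 0 t) (t t' : ℝ) : f t = f t' :=
  is_const_of_deriv_eq_zero (fun t => (h t).differentiableAt) (fun t => (h t).deriv) t t'

lemma affineFlow_snd (t : ℝ) (u : H.Nil × ℝ) : (affineFlow D ξ t u).2 = u.2 := by
  have h (t : ℝ) : HasDerivAt (fun t => (affineFlow D ξ t u).2) 0 t := by
    have := (hasDerivAt_affineFlow D ξ t u).snd
    rwa [affineField_apply] at this
  rw [eq_of_hasDerivAt_zero h t 0, affineFlow_zero]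
  rfl

/-- The one-parameter group generated by `ξ + D`. -/
def killingFlow (t : ℝ) (p : H.Nil) : H.Nil := (affineFlow D ξ t (p, 1)).1

/-- The differential of `killingFlow`. -/
def killingFlowDeriv (t : ℝ) : H.Nil →L[ℝ] H.Nil :=
  (ContinuousLinearMap.fst ℝ H.Nil ℝ ∘L affineFlow D ξ t) ∘L ContinuousLinearMap.inl ℝ H.Nil ℝ

lemma affineFlow_mk_one (t : ℝ) (p : H.Nil) :
    affineFlow D ξ t (p, 1) = (killingFlow D ξ t p, 1) :=
  Prod.ext rfl (affineFlow_snd D ξ t _)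

lemma affineFlow_mk_zero (t : ℝ) (u : H.Nil) :
    affineFlow D ξ t (u, 0) = (killingFlowDeriv D ξ t u, 0) :=
  Prod.ext rfl (affineFlow_snd D ξ t _)

lemma killingFlow_zero (p : H.Nil) : killingFlow D ξ 0 p = p := by
  rw [killingFlow, affineFlow_zero]; rfl

lemma killingFlowDeriv_zero (u : H.Nil) : killingFlowDeriv D ξ 0 u = u := by
  have h := affineFlow_mk_zero D ξ 0 u
  rw [affineFlow_zero] at h
  exact (congrArg Prod.fst h).symm

lemma killingFlow_add (t t' : ℝ) (p : H.Nil) :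
    killingFlow D ξ (t + t') p = killingFlow D ξ t (killingFlow D ξ t' p) := by
  rw [killingFlow, affineFlow_add, affineFlow_mk_one]; rfl

lemma killingFlowDeriv_neg (t : ℝ) (u : H.Nil) :
    killingFlowDeriv D ξ t (killingFlowDeriv D ξ (-t) u) = u := by
  have h := affineFlow_add D ξ t (-t) (u, 0)
  rw [add_neg_cancel, affineFlow_mk_zero, affineFlow_mk_zero, affineFlow_mk_zero,
    killingFlowDeriv_zero] at h
  exact (congrArg Prod.fst h).symm

lemma hasFDerivAt_killingFlow (t : ℝ) (p : H.Nil) :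
    HasFDerivAt (killingFlow D ξ t) (killingFlowDeriv D ξ t) p :=
  (ContinuousLinearMap.fst ℝ H.Nil ℝ ∘L affineFlow D ξ t).hasFDerivAt.comp p
    (hasFDerivAt_prodMk_left p (1 : ℝ))

lemma contDiff_killingFlow :
    ContDiff ℝ ∞ (fun x : ℝ × H.Nil => killingFlow D ξ x.1 x.2) :=
  contDiff_fst.comp <| ((contDiff_affineFlow D ξ).comp contDiff_fst).clm_apply
    (contDiff_snd.prodMk contDiff_const)

lemma hasDerivAt_killingFlow (t : ℝ) (p : H.Nil) : HasDerivAt (fun t => killingFlow D ξ t p)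
    (linearField D ξ (killingFlow D ξ t p) + ξ) t := by
  have h := (hasDerivAt_affineFlow D ξ t (p, 1)).fst
  rwa [affineField_apply, affineFlow_mk_one, one_smul] at h

lemma hasDerivAt_killingFlow_zero (t : ℝ) : HasDerivAt (fun t => killingFlow D ξ t 0)
    (killingFlowDeriv D ξ t ξ) t := by
  have h := (hasDerivAt_affineFlow' D ξ t (0, 1)).fst
  rwa [affineField_apply, map_zero, zero_add, one_smul, affineFlow_mk_zero] at h

lemma hasDerivAt_killingFlowDeriv (t : ℝ) (u : H.Nil) :
    HasDerivAt (fun t => killingFlowDeriv D ξ t u)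
      (linearField D ξ (killingFlowDeriv D ξ t u)) t := by
  have h := (hasDerivAt_affineFlow D ξ t (u, 0)).fst
  rwa [affineField_apply, affineFlow_mk_zero, zero_smul, add_zero] at h

variable {D}

/-- The left side is the derivative of `triv p u` when p and u move by the flow and its
differential. The ad ξ parts cancel, leaving D. -/
lemma triv_linearField (hD : IsSkewDerivation D) (p u : H.Nil) :
    triv p (linearField D ξ u) - (1 / 2 : ℝ) • ⁅linearField D ξ p + ξ, u⁆ = D (triv p u) := by
  simp only [triv, linearField_apply, map_sub, map_smul, hD.leibniz, lie_add, add_lie, lie_smul,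
    smul_lie, lie_lie_left, lie_lie_right, smul_zero]
  module

/-- Moved back to the identity, transported vectors satisfy θ' = D θ. With D skew, their scalar
products are constant, so the flow is isometric. -/
lemma hasDerivAt_triv (hD : IsSkewDerivation D) (t : ℝ) (p u : H.Nil) :
    HasDerivAt (fun t => triv (killingFlow D ξ t p) (killingFlowDeriv D ξ t u))
      (D (triv (killingFlow D ξ t p) (killingFlowDeriv D ξ t u))) t := by
  have h₁ := hasDerivAt_killingFlow D ξ t p
  have h₂ := hasDerivAt_killingFlowDeriv D ξ t u
  have h₃ := h₂.sub ((hasDerivAt_bilinear lieL h₁ h₂).const_smul (1 / 2 : ℝ))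
  convert! h₃ using 1
  rw [← triv_linearField ξ hD]
  simp only [triv, lieL_apply]
  module

lemma sp_eq_of_hasDerivAt (hD : IsSkewDerivation D) {a b : ℝ → H.Nil}
    (ha : ∀ t, HasDerivAt a (D (a t)) t) (hb : ∀ t, HasDerivAt b (D (b t)) t) (t t' : ℝ) :
    Nil.sp (a t) (b t) = Nil.sp (a t') (b t') := by
  refine eq_of_hasDerivAt_zero (f := fun t => Nil.sp (a t) (b t)) (fun t => ?_) t t'
  have h := hasDerivAt_bilinear spL (ha t) (hb t)
  simp only [spL_apply] at h
  convert! h using 1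
  rw [hD.skew]; ring

lemma hasDerivAt_lie (hD : IsSkewDerivation D) {a b : ℝ → H.Nil}
    (ha : ∀ t, HasDerivAt a (D (a t)) t) (hb : ∀ t, HasDerivAt b (D (b t)) t) (t : ℝ) :
    HasDerivAt (fun t => ⁅a t, b t⁆) (D ⁅a t, b t⁆) t := by
  have h := hasDerivAt_bilinear lieL (ha t) (hb t)
  simp only [lieL_apply] at h
  rwa [hD.leibniz, add_comm]

lemma isOneParameterIsometryGroup_killingFlow (hD : IsSkewDerivation D) :
    IsOneParameterIsometryGroup H.metric (killingFlow D ξ) where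
  smooth := contDiff_killingFlow D ξ
  zero := killingFlow_zero D ξ
  add := killingFlow_add D ξ
  isometry t := by
    refine ⟨(contDiff_killingFlow D ξ).comp (contDiff_const.prodMk contDiff_id), fun p u w => ?_⟩
    rw [(hasFDerivAt_killingFlow D ξ t p).fderiv, metric_apply, metric_apply,
      sp_eq_of_hasDerivAt hD (fun t => hasDerivAt_triv ξ hD t p u)
        (fun t => hasDerivAt_triv ξ hD t p w) t 0]
    simp only [killingFlow_zero, killingFlowDeriv_zero]

/-- The geodesic lemma: if `⟨D ξ, η⟩ = ⟨ξ, [ξ, η]⟩` for all `η`, then the orbit of the identity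
under the one-parameter group generated by `ξ + D` is a geodesic. -/
lemma isGeodesic_killingFlow (hD : IsSkewDerivation D)
    (hξ : ∀ η, Nil.sp (D ξ) η = Nil.sp ξ ⁅ξ, η⁆) :
    IsGeodesic H.metric (fun t => killingFlow D ξ t 0) := by
  refine ⟨(contDiff_killingFlow D ξ).comp (contDiff_id.prodMk contDiff_const), fun t w => ?_⟩
  have h₁ : deriv (fun t => killingFlow D ξ t 0) = fun t => killingFlowDeriv D ξ t ξ :=
    funext fun t => (hasDerivAt_killingFlow_zero D ξ t).deriv
  rw [h₁, (hasDerivAt_killingFlowDeriv D ξ t ξ).deriv]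
  -- The velocity is both the transport of ξ and the Killing field along the orbit, which turns the
  -- bracket in `triv_linearField` into a self-bracket.
  have h₂ := (hasDerivAt_killingFlow_zero D ξ t).unique (hasDerivAt_killingFlow D ξ t 0)
  have h₃ := triv_linearField ξ hD (killingFlow D ξ t 0) (killingFlowDeriv D ξ t ξ)
  rw [← h₂, lie_self, smul_zero, sub_zero] at h₃
  set θ : ℝ → H.Nil := fun t => triv (killingFlow D ξ t 0) (killingFlowDeriv D ξ t ξ) with hθ
  obtain ⟨u, rfl⟩ : ∃ u, killingFlowDeriv D ξ t u = w := ⟨_, killingFlowDeriv_neg D ξ t w⟩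
  set η : ℝ → H.Nil := fun t => triv (killingFlow D ξ t 0) (killingFlowDeriv D ξ t u) with hη
  have hθ' (t : ℝ) : HasDerivAt θ (D (θ t)) t := hasDerivAt_triv ξ hD t 0 ξ
  have hη' (t : ℝ) : HasDerivAt η (D (η t)) t := hasDerivAt_triv ξ hD t 0 u
  have hDθ (t : ℝ) : HasDerivAt (fun t => D (θ t)) (D (D (θ t))) t :=
    D.hasFDerivAt.comp_hasDerivAt t (hθ' t)
  -- D θ and [θ, η] solve the same linear equation as θ and η, so both sides are constant in t; at t
  -- = 0 the equality is `hξ`.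
  have key : Nil.sp (D (θ t)) (η t) = Nil.sp (θ t) ⁅θ t, η t⁆ := by
    rw [sp_eq_of_hasDerivAt hD hDθ hη' t 0,
      sp_eq_of_hasDerivAt hD hθ' (hasDerivAt_lie hD hθ' hη') t 0]
    simp only [hθ, hη, killingFlow_zero, killingFlowDeriv_zero, triv_zero_left, hξ]
  have hlie : ⁅θ t, η t⁆ = ⁅killingFlowDeriv D ξ t ξ, killingFlowDeriv D ξ t u⁆ := by
    simp only [hθ, hη, triv, sub_lie, lie_sub, smul_lie, lie_smul, lie_lie_left, lie_lie_right,
      smul_zero, sub_zero]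
  have hsp : Nil.sp (θ t) ⁅killingFlowDeriv D ξ t u, killingFlowDeriv D ξ t ξ⁆ =
      -Nil.sp (θ t) ⁅killingFlowDeriv D ξ t ξ, killingFlowDeriv D ξ t u⁆ := by
    rw [← lie_skew, ← spL_apply, map_neg, spL_apply]
  have h₀ : Nil.sp (η t) 0 = 0 := by rw [← spL_apply, map_zero]
  rw [fderiv_metric, fderiv_metric, metric_apply, h₃]
  change Nil.sp (D (θ t)) (η t)
    + -(1 / 2) * (Nil.sp (θ t) _ + Nil.sp (η t) _)
    - 1 / 2 * (-(1 / 2) * (Nil.sp (θ t) _ + Nil.sp (θ t) _)) = 0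
  rw [lie_self, h₀, hsp, key, hlie]
  ring

lemma isGeodesicOrbit_of_forall_exists
    (h : ∀ ξ : H.Nil, ∃ D : H.Nil →L[ℝ] H.Nil, IsSkewDerivation D ∧
      ∀ η, Nil.sp (D ξ) η = Nil.sp ξ ⁅ξ, η⁆) :
    IsGeodesicOrbit H.metric 1 := by
  refine ⟨isPseudoRiemannianMetric_metric, fun ξ => ?_⟩
  obtain ⟨D, hD, hξ⟩ := h ξ
  refine ⟨killingFlow D ξ, isOneParameterIsometryGroup_killingFlow ξ hD,
    isGeodesic_killingFlow ξ hD hξ, ?_⟩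
  rw [one_def, (hasDerivAt_killingFlow_zero D ξ 0).deriv, killingFlowDeriv_zero]

end Flow

end PseudoHType

/-! ### Skew derivations, the geodesic orbit property and natural reductivity. -/

namespace PseudoHType

open PE Nil

section General

variable {r s l : ℕ} (H : PseudoHType r s l)

lemma sp_J_J_polarized (a b : PE r s) (X Y : PE l l) :
    PE.sp (H.J a X) (H.J b Y) + PE.sp (H.J a Y) (H.J b X) = 2 * PE.sp a b * PE.sp X Y := by
  have h := H.sp_J_J a b (X + Y)
  simp only [map_add, PE.sp_add_left, PE.sp_add_right, sp_J_J, PE.sp_comm Y X] at h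
  linarith

/-- The map of `𝔫 = 𝔷 ⊕ 𝔳` with blocks `A` on `𝔷` and `B` on `𝔳`. -/
def blockMap (A : Module.End ℝ (PE r s)) (B : Module.End ℝ (PE l l)) : H.Nil →L[ℝ] H.Nil :=
  LinearMap.toContinuousLinearMap
    { toFun := fun a => Nil.mk (A (z a)) (B (v a))
      map_add' := fun a b => Nil.ext (by simp) (by simp)
      map_smul' := fun c a => Nil.ext (by simp) (by simp) }

lemma z_blockMap (A : Module.End ℝ (PE r s)) (B : Module.End ℝ (PE l l)) (a : H.Nil) :
    z (H.blockMap A B a) = A (z a) := rfl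

lemma v_blockMap (A : Module.End ℝ (PE r s)) (B : Module.End ℝ (PE l l)) (a : H.Nil) :
    v (H.blockMap A B a) = B (v a) := rfl

lemma isSkewDerivation_blockMap {A : Module.End ℝ (PE r s)} {B : Module.End ℝ (PE l l)}
    (hA : ∀ Z W, PE.sp (A Z) W = -PE.sp Z (A W)) (hB : ∀ X Y, PE.sp (B X) Y = -PE.sp X (B Y))
    (hAB : ∀ W, ⁅B, H.J W⁆ = H.J (A W)) : IsSkewDerivation (H.blockMap A B) where
  leibniz a b := by
    refine Nil.ext ?_ ?_
    · refine PE.eq_of_sp fun W => ?_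
      rw [map_add, z_blockMap, z_lie, z_lie, z_lie, v_blockMap, v_blockMap, hA, sp_bracket, ← hAB,
        PE.sp_add_left, sp_bracket, sp_bracket, Ring.lie_def, LinearMap.sub_apply,
        Module.End.mul_apply, Module.End.mul_apply, PE.sp_sub_left, hB]
      ring
    · rw [map_add, v_blockMap, v_lie, v_lie, v_lie, map_zero, add_zero]
  skew a b := by
    simp only [Nil.sp, z_blockMap, v_blockMap, hA (z a), hB (v a)]
    ring

/-- The inclusion of `𝔳` in `𝔫`. -/
def inclV : PE l l →ₗ[ℝ] H.Nil where
  toFun X := Nil.mk 0 X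
  map_add' X Y := Nil.ext (by simp) (by simp)
  map_smul' c X := Nil.ext (by simp) (by simp)

/-- The `𝔳`-block of a derivation of `𝔫`. -/
def vBlock (D : LieDerivation ℝ H.Nil H.Nil) : Module.End ℝ (PE l l) :=
  v ∘ₗ (D : H.Nil →ₗ[ℝ] H.Nil) ∘ₗ H.inclV

lemma vBlock_apply (D : LieDerivation ℝ H.Nil H.Nil) (X : PE l l) :
    H.vBlock D X = v (D (Nil.mk 0 X)) := rfl

end General

section Minimal

variable (H : PseudoHType 3 4 4)

/-- Since B normalizes 𝐕 and J is injective, ad B on 𝐕 transports to the block A on 𝔷. -/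
lemma exists_skewDerivation_of_mem_commV {B : Module.End ℝ (PE 4 4)} (hB : B ∈ H.commV) :
    ∃ A : Module.End ℝ (PE 3 4), (∀ W, ⁅B, H.J W⁆ = H.J (A W)) ∧
      IsSkewDerivation (H.blockMap A B) := by
  obtain ⟨g, hg⟩ := LinearMap.exists_leftInverse_of_injective H.J
    (LinearMap.ker_eq_bot.2 H.J_injective)
  set A : Module.End ℝ (PE 3 4) :=
    g ∘ₗ (LinearMap.mulLeft ℝ B - LinearMap.mulRight ℝ B) ∘ₗ H.J with hA
  have hAB (W : PE 3 4) : ⁅B, H.J W⁆ = H.J (A W) := by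
    obtain ⟨w, hw⟩ := H.lie_mem_V_of_mem_commV hB W
    have h : A W = g ⁅B, H.J W⁆ := rfl
    rw [h, ← hw]
    exact congrArg H.J (LinearMap.congr_fun hg w).symm
  have hskew := H.skew_of_mem_commV hB
  refine ⟨A, hAB, H.isSkewDerivation_blockMap (fun Z W => ?_) hskew hAB⟩
  -- For a unit vector X, ⟨J_a X, J_b X⟩ = ⟨a, b⟩, so skewness of A can be tested on 𝔳. The leftover
  -- term contains ⟨X, B X⟩ = 0.
  set X : PE 4 4 := PE.e (Sum.inl 0)
  have hX : PE.sp X X = 1 := by simp [X, PE.sp_e_self, PE.sign]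
  have h₁ := H.sp_J_J (A Z) W X
  have h₂ := H.sp_J_J Z (A W) X
  have h₃ := H.sp_J_J_polarized Z W X (B X)
  have h₄ := hskew X X
  have h₅ := hskew (H.J Z X) (H.J W X)
  rw [← hAB, Ring.lie_def, LinearMap.sub_apply, Module.End.mul_apply, Module.End.mul_apply, hX]
    at h₁ h₂
  rw [PE.sp_sub_left] at h₁
  rw [PE.sp_sub_right] at h₂
  rw [PE.sp_comm] at h₄
  have h₆ : PE.sp X (B X) = 0 := by linarith
  rw [h₆] at h₃
  linarith

theorem isGeodesicOrbit_metric : IsGeodesicOrbit H.metric 1 := by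
  refine isGeodesicOrbit_of_forall_exists fun ξ => ?_
  obtain ⟨B, hB, hlie, hBv⟩ := H.exists_commV_apply_eq (z ξ) (v ξ)
  obtain ⟨A, hAB, hD⟩ := H.exists_skewDerivation_of_mem_commV hB
  refine ⟨_, hD, fun η => ?_⟩
  have hA : A (z ξ) = 0 := H.J_injective (by rw [← hAB, hlie, map_zero])
  simp only [Nil.sp, z_blockMap, v_blockMap, hA, hBv, z_lie, v_lie, PE.sp_zero_left,
    PE.sp_zero_right, PE.sp_comm (z ξ), sp_bracket]
  ring

/-- For a unit vector X, Z = [X, J_Z X], and a derivation sends brackets to sums of brackets, which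
lie in 𝔷. -/
lemma v_derivation_mk_zero (D : LieDerivation ℝ H.Nil H.Nil) (Z : PE 3 4) :
    v (D (Nil.mk Z 0)) = 0 := by
  set X : PE 4 4 := PE.e (Sum.inl 0)
  have hX : PE.sp X X = 1 := by simp [X, PE.sp_e_self, PE.sign]
  have h : (Nil.mk Z 0 : H.Nil) = ⁅(Nil.mk 0 X : H.Nil), (Nil.mk 0 (H.J Z X) : H.Nil)⁆ := by
    rw [lie_def, v_mk, v_mk, bracket_J, hX, one_smul]
  rw [h, LieDerivation.apply_lie_eq_sub, map_sub, v_lie, v_lie, sub_zero]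

/-- Skewness makes D preserve 𝔳, since it preserves 𝔷. The Leibniz rule paired with W then reads [B,
J_W] = J_{D W} for the 𝔳-block B of D. -/
lemma vBlock_mem_normalizerV {D : LieDerivation ℝ H.Nil H.Nil} (hD : D ∈ H.isotropy) :
    H.vBlock D ∈ H.normalizerV := by
  replace hD : ∀ a b, Nil.sp (D a) b = -Nil.sp a (D b) := hD
  have hz (X : PE 4 4) : z (D (Nil.mk 0 X)) = 0 := by
    refine PE.eq_zero_of_sp _ fun Z => ?_
    have h := hD (Nil.mk 0 X) (Nil.mk Z 0)
    simpa [Nil.sp, v_derivation_mk_zero, PE.sp_zero_left, PE.sp_zero_right] using h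
  have hskew (X Y : PE 4 4) : PE.sp (H.vBlock D X) Y = -PE.sp X (H.vBlock D Y) := by
    have h := hD (Nil.mk 0 X) (Nil.mk 0 Y)
    simpa [Nil.sp, vBlock_apply, PE.sp_zero_left, PE.sp_zero_right] using h
  have hmk (X : PE 4 4) : D (Nil.mk 0 X) = Nil.mk 0 (H.vBlock D X) := Nil.ext (hz X) rfl
  refine ⟨hskew, ?_⟩
  rintro _ ⟨W, rfl⟩
  refine ⟨z (D (Nil.mk W 0)), LinearMap.ext fun X => PE.eq_of_sp fun Y => ?_⟩
  have h₁ := D.apply_lie_eq_add (Nil.mk 0 X) (Nil.mk 0 Y)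
  have h₂ := hD ⁅(Nil.mk 0 X : H.Nil), (Nil.mk 0 Y : H.Nil)⁆ (Nil.mk W 0)
  rw [h₁, hmk, hmk] at h₂
  simp only [Nil.sp, map_add, z_lie, v_lie, v_mk, z_mk, PE.sp_zero_left, PE.sp_zero_right,
    PE.sp_add_left, sp_bracket, add_zero] at h₂
  rw [Ring.lie_def, LinearMap.sub_apply, Module.End.mul_apply, Module.End.mul_apply,
    PE.sp_sub_left, hskew]
  linarith

theorem not_isNaturallyReductive : ¬ H.IsNaturallyReductive := by
  rintro ⟨𝔤, 𝔨, 𝔪, htrans, h𝔨, -, hsup, -, hnat⟩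
  -- Subtracting the 𝔨-component does not change the class in 𝔫.
  have hex (a : H.Nil) : ∃ T ∈ 𝔪, T.left = a := by
    obtain ⟨ξ, hξ, rfl⟩ := htrans a
    have hmem : ξ ∈ 𝔨 ⊔ 𝔪 := by rw [hsup]; exact hξ
    obtain ⟨κ, hκ, T, hT, rfl⟩ := Submodule.mem_sup.1 hmem
    refine ⟨T, hT, ?_⟩
    rw [LieAlgebra.SemiDirectSum.add_eq_mk, ((h𝔨 κ).1 hκ).2, zero_add]
  set Z : PE 3 4 := PE.e (Sum.inl 0)
  obtain ⟨Q, hQ, hQl⟩ := hex (Nil.mk Z 0)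
  -- Write T, Q, R for elements of 𝔪 over X, Z, Y, with isotropy parts D_T, D_Q, D_R. As D_T and D_R
  -- preserve 𝔷 and 𝔳, the condition reduces to ⟨D_Q X, Y⟩ = ⟨Z, [X, Y]⟩ = ⟨J_Z X, Y⟩.
  have hblock : H.vBlock (Q.right : LieDerivation ℝ H.Nil H.Nil) = H.J Z := by
    refine LinearMap.ext fun X => PE.eq_of_sp fun Y => ?_
    obtain ⟨T, hT, hTl⟩ := hex (Nil.mk 0 X)
    obtain ⟨R, hR, hRl⟩ := hex (Nil.mk 0 Y)
    have h := hnat T hT Q hQ R hR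
    have hTs : ∀ a b, Nil.sp ((T.right : LieDerivation ℝ H.Nil H.Nil) a) b =
      -Nil.sp a ((T.right : LieDerivation ℝ H.Nil H.Nil) b) := T.right.2
    have hRs : ∀ a b, Nil.sp ((R.right : LieDerivation ℝ H.Nil H.Nil) a) b =
      -Nil.sp a ((R.right : LieDerivation ℝ H.Nil H.Nil) b) := R.right.2
    have hTQ := hTs (Nil.mk Z 0) (Nil.mk 0 Y)
    have hRX := hRs (Nil.mk Z 0) (Nil.mk 0 X)
    simp only [LieAlgebra.SemiDirectSum.lie_eq_mk, hQl, hTl, hRl, LieSubalgebra.coe_incl] at h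
    simp only [Nil.sp, map_add, map_sub, z_lie, v_lie, z_mk, v_mk, PE.sp_zero_left,
      PE.sp_zero_right, PE.sp_add_left, PE.sp_sub_left, PE.sp_add_right, PE.sp_sub_right,
      v_derivation_mk_zero, map_zero, PE.sp_comm Z, sp_bracket] at h hTQ hRX
    rw [vBlock_apply]
    linarith
  have h := H.J_eq_zero_of_mem_normalizerV (hblock ▸ H.vBlock_mem_normalizerV Q.right.2)
  have hZ : Z = 0 := H.J_injective (by rw [h, map_zero])
  have h₁ : PE.sp Z Z = 1 := by simp [Z, PE.sp_e_self, PE.sign]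
  rw [hZ, PE.sp_zero_left] at h₁
  exact zero_ne_one h₁

end Minimal

end PseudoHType

end

/-- `H : PseudoHType 3 4 4` is an arbitrary pseudo `H`-type structure with centre `ℝ^{3,4}` on the
minimal admissible module `𝔳 = ℝ^{4,4}`; its group is `N_{3,4}`. -/
theorem theorem6p3 (H : PseudoHType 3 4 4) :
    H.normalizerV = (H.commV : Set (Module.End ℝ (PE 4 4))) ∧
    (∀ Z ∈ H.V, ∀ Y : PE 4 4, ∃ B ∈ H.commV, ⁅B, Z⁆ = 0 ∧ B Y = Z Y) ∧
    IsGeodesicOrbit H.metric 1 ∧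
    ¬ H.IsNaturallyReductive := by
  refine ⟨H.normalizerV_eq_commV, ?_, H.isGeodesicOrbit_metric, H.not_isNaturallyReductive⟩
  rintro _ ⟨z, rfl⟩ Y
  exact H.exists_commV_apply_eq z Y
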